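/- Let $n$ be a positive integer with $n\equiv\pm3\pmod 8$. (1) Let $f\in\mathbb{F}_2[x]$ be an irreducible polynomial of degree $n$, let $\alpha\in\mathbb{F}_{2^n}$ be a root of $f$, and suppose that $\mathrm{Tr}(\alpha^i)=0$ for all $1\le i<n$, where $\mathrm{Tr}$ denotes the trace from $\mathbb{F}_{2^n}$ to $\mathbb{F}_2$. Then $f$ contains a term $x^k$ (that is, the coefficient of $x^k$ in $f$ is nonzero) with $n>k\ge n/3$. (2) In particular, if $m_1>m_2>m_3>0$ are odd integers with $m_1<n/3$, then the pentanomial $x^n+x^{m_1}+x^{m_2}+x^{m_3}+1\in\mathbb{F}_2[x]$ is not irreducible. -/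

import Mathlib

open Polynomial

/-! The discriminant of an integral lift is computed modulo 8 in two ways. Suppose `f` is
irreducible and its middle exponents are odd and below n/3; let `F = sparsePoly n S` be its 0/1
lift. Stickelberger side (`exists_int_det_vandermonde_sq`): Frobenius acts on the roots of `f` as an
n-cycle, which is even for n odd, and this forces disc F ≡ 1 mod 8. Explicit side
(`exists_prod_eval_derivative_sparsePoly`): at a root x of F, xF'(x) = -n + 2w with w a combination
of the x^i, i ∈ S. By Newton's identities the power sums of the roots vanish up to 2n/3, so w and w²
both sum to zero over the roots, and ∏ F'(x) ≡ n^n ≡ n mod 8. The two values agree up to sign, so n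
≡ ±1 mod 8, a contradiction. For (1), vanishing traces force the middle exponents to be odd
(`odd_of_coeff_ne_zero_of_trace`). -/

/-! ### Symmetric functions of roots and Newton's identities. -/

theorem aeval_esymm_of_prod {R : Type*} [CommRing R] {n : ℕ} (x : Fin n → R) {g : R[X]}
    (hg : g = ∏ i, (X - C (x i))) {k : ℕ} (hk : k ≤ n) :
    MvPolynomial.aeval x (MvPolynomial.esymm (Fin n) ℤ k) = (-1) ^ k * g.coeff (n - k) := by
  have h := Multiset.prod_X_sub_C_coeff ((Finset.univ : Finset (Fin n)).val.map x)
    (k := n - k) (by simp)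
  rw [Multiset.map_map] at h
  simp only [Multiset.card_map, Finset.card_val, Finset.card_univ, Fintype.card_fin,
    Nat.sub_sub_self hk] at h
  rw [MvPolynomial.aeval_esymm_eq_multiset_esymm, hg, Finset.prod]
  have h' : (Multiset.map ((fun t => X - C t) ∘ x) (Finset.univ : Finset (Fin n)).val)
      = Multiset.map (fun i => X - C (x i)) (Finset.univ : Finset (Fin n)).val := rfl
  rw [← h', h, ← mul_assoc, ← mul_pow]
  simp

theorem sum_pow_eq_zero_of_esymm {R : Type*} [CommRing R] {n : ℕ} (x : Fin n → R) (m : ℕ)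
    (h : ∀ k, 0 < k → k ≤ m → MvPolynomial.aeval x (MvPolynomial.esymm (Fin n) ℤ k) = 0)
    {k : ℕ} (hk : 0 < k) (hkm : k ≤ m) : ∑ i, x i ^ k = 0 := by
  have := congrArg (MvPolynomial.aeval x) (MvPolynomial.psum_eq_mul_esymm_sub_sum (Fin n) ℤ k hk)
  simp only [MvPolynomial.psum, map_sum, map_pow, MvPolynomial.aeval_X, map_sub, map_mul,
    h k hk hkm, mul_zero, zero_sub] at this
  rw [this, Finset.sum_eq_zero, neg_zero]
  intro a ha
  have ha' := (Finset.mem_filter.1 ha).2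
  rw [Set.mem_Ioo] at ha'
  rw [h a.1 ha'.1 (by omega)]
  simp

theorem mul_esymm_eq_zero_of_sum_pow {R : Type*} [CommRing R] {n : ℕ} (x : Fin n → R) (m : ℕ)
    (h : ∀ k, 0 < k → k ≤ m → ∑ i, x i ^ k = 0) {k : ℕ} (hk : k ≤ m) :
    (k : R) * MvPolynomial.aeval x (MvPolynomial.esymm (Fin n) ℤ k) = 0 := by
  have := congrArg (MvPolynomial.aeval x) (MvPolynomial.mul_esymm_eq_sum (Fin n) ℤ k)
  simp only [map_sum, map_mul, map_natCast] at this
  rw [this, Finset.sum_eq_zero, mul_zero]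
  intro a ha
  have ha1 := Finset.HasAntidiagonal.mem_antidiagonal.1 (Finset.mem_filter.1 ha).1
  have ha2 := (Finset.mem_filter.1 ha).2
  simp only [MvPolynomial.psum, map_sum, map_pow, MvPolynomial.aeval_X]
  rw [h a.2 (by omega) (by omega), mul_zero]

theorem aeval_aeval_esymm_of_prod {R : Type*} [CommRing R] {n : ℕ} (F : ℤ[X]) (x : Fin n → R)
    (hx : F.map (Int.castRingHom R) = ∏ i, (X - C (x i))) (h : MvPolynomial (Fin n) ℤ) :
    MvPolynomial.aeval x
        (MvPolynomial.aeval (fun i : Fin n ↦ MvPolynomial.esymm (Fin n) ℤ (i + 1)) h) =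
      ((MvPolynomial.aeval (fun i : Fin n ↦ (-1) ^ (i.1 + 1) * F.coeff (n - (i + 1))) h : ℤ)
        : R) := by
  induction h using MvPolynomial.induction_on with
  | C a => simp
  | add p q hp hq => simp only [map_add, hp, hq, Int.cast_add]
  | mul_X p i hp =>
    simp only [map_mul, hp, MvPolynomial.aeval_X, aeval_esymm_of_prod x hx i.2,
      coeff_map, Int.cast_mul, Int.cast_pow, Int.cast_neg, Int.cast_one, eq_intCast]

/-- A symmetric polynomial takes the same integer value at the roots of a monic integral
polynomial in all rings over which it splits. -/
theorem exists_int_aeval_of_isSymmetric {R S : Type*} [CommRing R] [CommRing S] {n : ℕ}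
    (F : ℤ[X]) (x : Fin n → R) (y : Fin n → S)
    (hx : F.map (Int.castRingHom R) = ∏ i, (X - C (x i)))
    (hy : F.map (Int.castRingHom S) = ∏ i, (X - C (y i)))
    {g : MvPolynomial (Fin n) ℤ} (hg : g.IsSymmetric) :
    ∃ N : ℤ, MvPolynomial.aeval x g = (N : R) ∧ MvPolynomial.aeval y g = (N : S) := by
  obtain ⟨h, hh⟩ := MvPolynomial.esymmAlgHom_surjective (σ := Fin n) ℤ (n := n) (by simp) ⟨g, hg⟩
  have hg' : g = MvPolynomial.aeval (fun i : Fin n ↦ MvPolynomial.esymm (Fin n) ℤ (i + 1)) h := by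
    rw [← MvPolynomial.esymmAlgHom_apply, hh]
  rw [hg']
  exact ⟨_, aeval_aeval_esymm_of_prod F x hx h, aeval_aeval_esymm_of_prod F y hy h⟩

/-! ### Stickelberger's congruence. -/

/-- The sum of the terms of the Vandermonde determinant coming from permutations of sign `e`. -/
noncomputable def halfVandermonde {R : Type*} [CommRing R] {n : ℕ} (x : Fin n → R) (e : ℤˣ) : R :=
  ∑ σ : Equiv.Perm (Fin n) with Equiv.Perm.sign σ = e, ∏ i, x (σ i) ^ (i : ℕ)

theorem det_vandermonde_eq_halfVandermonde_sub {R : Type*} [CommRing R] {n : ℕ} (x : Fin n → R) :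
    (Matrix.vandermonde x).det = halfVandermonde x 1 - halfVandermonde x (-1) := by
  rw [Matrix.det_apply, ← Finset.sum_filter_add_sum_filter_not _
    (fun σ : Equiv.Perm (Fin n) ↦ Equiv.Perm.sign σ = 1), sub_eq_add_neg, halfVandermonde,
    halfVandermonde, ← Finset.sum_neg_distrib]
  congr 1
  · refine Finset.sum_congr rfl fun σ hσ ↦ ?_
    simp [(Finset.mem_filter.1 hσ).2]
  · refine Finset.sum_congr ?_ fun σ hσ ↦ ?_
    · ext σ
      rcases Int.units_eq_one_or (Equiv.Perm.sign σ) with h | h <;> simp [h]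
    · simp [(Finset.mem_filter.1 hσ).2]

theorem map_halfVandermonde {R S : Type*} [CommRing R] [CommRing S] (φ : R →+* S) {n : ℕ}
    (x : Fin n → R) (e : ℤˣ) : φ (halfVandermonde x e) = halfVandermonde (φ ∘ x) e := by
  simp [halfVandermonde]

theorem halfVandermonde_comp_perm {R : Type*} [CommRing R] {n : ℕ} (x : Fin n → R)
    (τ : Equiv.Perm (Fin n)) (e : ℤˣ) :
    halfVandermonde (x ∘ τ) e = halfVandermonde x (Equiv.Perm.sign τ * e) := by
  refine Finset.sum_equiv (Equiv.mulLeft τ) (fun σ ↦ ?_) fun σ _ ↦ ?_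
  · simp
  · simp

theorem rename_halfVandermonde_X {n : ℕ} (τ : Equiv.Perm (Fin n)) (e : ℤˣ) :
    MvPolynomial.rename τ (halfVandermonde (MvPolynomial.X : Fin n → MvPolynomial (Fin n) ℤ) e) =
      halfVandermonde MvPolynomial.X (Equiv.Perm.sign τ * e) := by
  rw [← halfVandermonde_comp_perm]
  refine (map_halfVandermonde (MvPolynomial.rename (R := ℤ) τ).toRingHom _ _).trans ?_
  congr 1
  ext1 i
  simp

theorem isSymmetric_halfVandermonde_add {n : ℕ} :
    (halfVandermonde (MvPolynomial.X : Fin n → MvPolynomial (Fin n) ℤ) 1 +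
      halfVandermonde MvPolynomial.X (-1)).IsSymmetric := by
  intro τ
  rw [map_add, rename_halfVandermonde_X, rename_halfVandermonde_X]
  rcases Int.units_eq_one_or (Equiv.Perm.sign τ) with h | h <;> simp [h, add_comm]

theorem isSymmetric_halfVandermonde_mul {n : ℕ} :
    (halfVandermonde (MvPolynomial.X : Fin n → MvPolynomial (Fin n) ℤ) 1 *
      halfVandermonde MvPolynomial.X (-1)).IsSymmetric := by
  intro τ
  rw [map_mul, rename_halfVandermonde_X, rename_halfVandermonde_X]
  rcases Int.units_eq_one_or (Equiv.Perm.sign τ) with h | h <;> simp [h, mul_comm]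

theorem aeval_halfVandermonde_X {R : Type*} [CommRing R] {n : ℕ} (x : Fin n → R) (e : ℤˣ) :
    MvPolynomial.aeval x (halfVandermonde (MvPolynomial.X : Fin n → MvPolynomial (Fin n) ℤ) e) =
      halfVandermonde x e := by
  refine (map_halfVandermonde (MvPolynomial.aeval x : _ →ₐ[ℤ] R).toRingHom _ _).trans ?_
  congr 1
  ext1 i
  simp

/-- The half Vandermonde sums at the conjugates of an element of odd degree over `𝔽₂` lie in
`{0, 1}`. -/
theorem halfVandermonde_sq_of_frobenius {K : Type*} [Field K] [CharP K 2] {n : ℕ} (hn : Odd n)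
    (y : Fin n → K) (hy : ∀ i, y i ^ 2 = y (finRotate n i)) (e : ℤˣ) :
    halfVandermonde y e = 0 ∨ halfVandermonde y e = 1 := by
  have h : halfVandermonde y e ^ 2 = halfVandermonde y e := by
    have h1 := map_halfVandermonde (frobenius K 2) y e
    have h2 : frobenius K 2 ∘ y = y ∘ finRotate n := by
      ext1 i
      simp [frobenius_def, hy]
    -- An n-cycle with n odd is even, so Frobenius fixes each half sum.
    rw [h2, halfVandermonde_comp_perm, sign_finRotate, Even.neg_one_pow (hn.tsub_odd odd_one),
      one_mul, frobenius_def] at h1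
    exact h1
  rw [sq] at h
  rcases eq_or_ne (halfVandermonde y e) 0 with h0 | h0
  · exact Or.inl h0
  · exact Or.inr (mul_left_cancel₀ h0 (by rw [h, mul_one]))

/-- Stickelberger's congruence for a polynomial of odd degree that is irreducible modulo `2`. -/
theorem exists_int_det_vandermonde_sq {R K : Type*} [CommRing R] [Field K] [CharP K 2] {n : ℕ}
    (hn : Odd n) (F : ℤ[X]) (x : Fin n → R) (y : Fin n → K)
    (hx : F.map (Int.castRingHom R) = ∏ i, (X - C (x i)))
    (hyF : F.map (Int.castRingHom K) = ∏ i, (X - C (y i)))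
    (hy : ∀ i, y i ^ 2 = y (finRotate n i)) (hinj : Function.Injective y) :
    ∃ N : ℤ, (Matrix.vandermonde x).det ^ 2 = (N : R) ∧ N ≡ 1 [ZMOD 8] := by
  obtain ⟨A, hA, hA'⟩ := exists_int_aeval_of_isSymmetric F x y hx hyF isSymmetric_halfVandermonde_add
  obtain ⟨B, hB, hB'⟩ := exists_int_aeval_of_isSymmetric F x y hx hyF isSymmetric_halfVandermonde_mul
  simp only [map_add, map_mul, aeval_halfVandermonde_X] at hA hA' hB hB'
  have hdet : halfVandermonde y 1 - halfVandermonde y (-1) ≠ 0 := by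
    rw [← det_vandermonde_eq_halfVandermonde_sub]
    exact Matrix.det_vandermonde_ne_zero_iff.2 hinj
  -- The half sums lie in {0, 1} and differ, so one is 0 and the other is 1.
  have hAB : (A : K) = 1 ∧ (B : K) = 0 := by
    rw [← hA', ← hB']
    rcases halfVandermonde_sq_of_frobenius hn y hy 1 with h1 | h1 <;>
    rcases halfVandermonde_sq_of_frobenius hn y hy (-1) with h2 | h2 <;>
    rw [h1, h2] at hdet ⊢ <;>
    simp [CharTwo.neg_eq] at hdet ⊢
  have hA1 : (2 : ℤ) ∣ A - 1 := by
    rw [← Nat.cast_two, ← CharP.intCast_eq_zero_iff K 2]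
    simp [hAB.1]
  have hB1 : (2 : ℤ) ∣ B := by
    rw [← Nat.cast_two, ← CharP.intCast_eq_zero_iff K 2]
    simp [hAB.2]
  -- (u - v)² = (u + v)² - 4uv; with A odd and B even this is 1 mod 8.
  refine ⟨A ^ 2 - 4 * B, ?_, ?_⟩
  · rw [det_vandermonde_eq_halfVandermonde_sub]
    push_cast
    rw [← hA, ← hB]
    ring
  · obtain ⟨a, ha⟩ := hA1
    obtain ⟨b, rfl⟩ := hB1
    obtain rfl : A = 2 * a + 1 := by omega
    obtain ⟨c, hc⟩ := Int.even_mul_succ_self a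
    refine (Int.modEq_iff_dvd.2 ⟨b - c, ?_⟩)
    linear_combination (-4) * hc

/-! ### The discriminant of a sparse polynomial modulo 8. -/

/-- Expansion in elementary symmetric functions of `w`, with `e` the second one; terms of degree at
least 3 are divisible by 8. The factor `a ^ 2` avoids the exponent `s.card - 2`. -/
theorem exists_prod_add_two_mul {R ι : Type*} [CommRing R] (a : R) (w : ι → R) (s : Finset ι) :
    ∃ e z : R, 2 * e = (∑ i ∈ s, w i) ^ 2 - ∑ i ∈ s, w i ^ 2 ∧
      a ^ 2 * ∏ i ∈ s, (a + 2 * w i) =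
        a ^ s.card * (a ^ 2 + 2 * a * ∑ i ∈ s, w i + 4 * e) + 8 * z := by
  classical
  induction s using Finset.induction_on with
  | empty => exact ⟨0, 0, by simp, by simp⟩
  | insert i s hi ih =>
    obtain ⟨e, z, he, hz⟩ := ih
    refine ⟨e + (∑ i ∈ s, w i) * w i, z * (a + 2 * w i) + a ^ s.card * e * w i, ?_, ?_⟩
    · rw [Finset.sum_insert hi, Finset.sum_insert hi]
      linear_combination he
    · rw [Finset.sum_insert hi, Finset.prod_insert hi, Finset.card_insert_of_notMem hi]
      linear_combination (a + 2 * w i) * hz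

theorem exists_neg_one_pow_mul_det_vandermonde_sq {R : Type*} [CommRing R] {n : ℕ}
    (x : Fin n → R) :
    ∃ m : ℕ, ∏ i, ∏ j ∈ {i}ᶜ, (x i - x j) = (-1) ^ m * (Matrix.vandermonde x).det ^ 2 := by
  refine ⟨∑ i : Fin n, (Finset.Ioi i).card, ?_⟩
  rw [← Finset.prod_prod_Ioi_mul_eq_prod_prod_off_diag (fun j i ↦ x i - x j),
    Matrix.det_vandermonde, ← Finset.prod_pow, ← Finset.prod_pow_eq_pow_sum,
    ← Finset.prod_mul_distrib]
  refine Finset.prod_congr rfl fun i _ ↦ ?_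
  rw [← Finset.prod_pow, ← Finset.prod_const, ← Finset.prod_mul_distrib]
  exact Finset.prod_congr rfl fun j _ ↦ by ring

theorem eval_derivative_prod_X_sub_C {R : Type*} [CommRing R] {n : ℕ} (x : Fin n → R) (i : Fin n) :
    (derivative (∏ j, (X - C (x j)))).eval (x i) = ∏ j ∈ {i}ᶜ, (x i - x j) := by
  rw [Polynomial.derivative_prod_finset, eval_finsetSum, Finset.sum_eq_single i]
  · simp [eval_prod, Finset.compl_singleton]
  · intro j _ hj
    rw [eval_mul, eval_prod, Finset.prod_eq_zero (i := i) (by simp [hj.symm]) (by simp), zero_mul]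
  · simp

/-- `x ^ n + ∑ i ∈ S, x ^ i + 1`. -/
noncomputable def sparsePoly (n : ℕ) (S : Finset ℕ) : ℤ[X] := X ^ n + ∑ i ∈ S, X ^ i + 1

theorem coeff_sparsePoly (n : ℕ) (S : Finset ℕ) (k : ℕ) :
    (sparsePoly n S).coeff k =
      (if k = n then 1 else 0) + (if k ∈ S then 1 else 0) + (if k = 0 then 1 else 0) := by
  simp [sparsePoly, coeff_X_pow, coeff_one]

section

variable {R : Type*} [CommRing R] {n : ℕ} {S : Finset ℕ} {x : Fin n → R}

theorem sum_pow_roots_sparsePoly (hS : ∀ i ∈ S, 0 < i ∧ 3 * i < n)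
    (hx : (sparsePoly n S).map (Int.castRingHom R) = ∏ i, (X - C (x i)))
    {k : ℕ} (hk : 0 < k) (hkn : 3 * k ≤ 2 * n) : ∑ i, x i ^ k = 0 := by
  refine sum_pow_eq_zero_of_esymm x k (fun m hm hmk ↦ ?_) hk le_rfl
  rw [aeval_esymm_of_prod x hx (by omega), coeff_map, coeff_sparsePoly, if_neg (by omega),
    if_neg (fun h ↦ by have := hS _ h; omega), if_neg (by omega)]
  simp

theorem prod_roots_sparsePoly (hn : Odd n) (hS : ∀ i ∈ S, 0 < i)
    (hx : (sparsePoly n S).map (Int.castRingHom R) = ∏ i, (X - C (x i))) : ∏ i, x i = -1 := by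
  have h := congrArg (eval 0) hx
  have h0 : (sparsePoly n S).coeff 0 = 1 := by
    rw [coeff_sparsePoly, if_neg hn.pos.ne, if_neg fun h ↦ (hS 0 h).ne rfl]
    simp
  rw [← coeff_zero_eq_eval_zero, coeff_map, h0, eval_prod] at h
  simp only [eval_sub, eval_X, eval_C, zero_sub, Finset.prod_neg, Finset.card_univ,
    Fintype.card_fin, hn.neg_one_pow, map_one] at h
  linear_combination h

theorem root_mul_eval_derivative_sparsePoly (hn : Odd n) (hS : ∀ i ∈ S, Odd i) {r : R}
    (hr : ((sparsePoly n S).map (Int.castRingHom R)).eval r = 0) :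
    r * (derivative ((sparsePoly n S).map (Int.castRingHom R))).eval r =
      -(n : R) + 2 * ∑ i ∈ S, ((((i : ℤ) - n) / 2 : ℤ) : R) * r ^ i := by
  have hpow : ∀ i : ℕ, 0 < i → r * r ^ (i - 1) = r ^ i := fun i hi ↦ by
    rw [← pow_succ', Nat.sub_add_cancel hi]
  simp only [sparsePoly, Polynomial.map_add, Polynomial.map_pow, Polynomial.map_X,
    Polynomial.map_sum, Polynomial.map_one, eval_add, eval_pow, eval_X, eval_finsetSum,
    eval_one] at hr
  simp only [sparsePoly, Polynomial.map_add, Polynomial.map_pow, Polynomial.map_X,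
    Polynomial.map_sum, Polynomial.map_one, derivative_add, derivative_X_pow, derivative_sum,
    derivative_one, eval_add, eval_mul, eval_pow, eval_X, eval_finsetSum,
    eval_C, add_zero, mul_add, Finset.mul_sum]
  have h1 : ∑ i ∈ S, r * ((i : R) * r ^ (i - 1)) = ∑ i ∈ S, (n : R) * r ^ i +
      ∑ i ∈ S, 2 * (((((i : ℤ) - n) / 2 : ℤ) : R) * r ^ i) := by
    rw [← Finset.sum_add_distrib]
    refine Finset.sum_congr rfl fun i hi ↦ ?_
    -- The integer division is exact because i and n are both odd.
    have h2 : (2 : ℤ) * (((i : ℤ) - n) / 2) = i - n := by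
      have := hS i hi
      rcases this with ⟨a, rfl⟩
      rcases hn with ⟨b, rfl⟩
      push_cast
      omega
    have h3 : (2 : R) * ((((i : ℤ) - n) / 2 : ℤ) : R) = i - n := by
      have := congrArg (Int.cast (R := R)) h2
      push_cast at this
      exact this
    linear_combination (i : R) * hpow i (hS i hi).pos - r ^ i * h3
  rw [h1, ← Finset.mul_sum]
  linear_combination (n : R) * hpow n hn.pos + (n : R) * hr

theorem exists_prod_eval_derivative_sparsePoly [IsDomain R] [CharZero R] (hn : Odd n)
    (hS : ∀ i ∈ S, Odd i ∧ 3 * i < n)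
    (hx : (sparsePoly n S).map (Int.castRingHom R) = ∏ i, (X - C (x i))) :
    ∃ z : R, (n : R) ^ 2 * ∏ i, ∏ j ∈ {i}ᶜ, (x i - x j) = (n : R) ^ (n + 2) + 8 * z := by
  set w : Fin n → R := fun j ↦ ∑ i ∈ S, ((((i : ℤ) - n) / 2 : ℤ) : R) * x j ^ i with hw
  have hS' : ∀ i ∈ S, 0 < i ∧ 3 * i < n := fun i hi ↦ ⟨(hS i hi).1.pos, (hS i hi).2⟩
  have hw1 : ∑ j, w j = 0 := by
    simp only [hw]
    rw [Finset.sum_comm]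
    refine Finset.sum_eq_zero fun i hi ↦ ?_
    have := hS' i hi
    rw [← Finset.mul_sum, sum_pow_roots_sparsePoly hS' hx this.1 (by omega), mul_zero]
  have hw2 : ∑ j, w j ^ 2 = 0 := by
    simp only [hw, sq, Finset.sum_mul_sum]
    rw [Finset.sum_comm]
    refine Finset.sum_eq_zero fun i hi ↦ ?_
    rw [Finset.sum_comm]
    refine Finset.sum_eq_zero fun k hk ↦ ?_
    have h1 := hS' i hi
    have h2 := hS' k hk
    -- Here the bound n/3 is used: i + k < 2n/3.
    have h3 := sum_pow_roots_sparsePoly hS' hx (k := i + k) (by omega) (by omega)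
    rw [← mul_zero (((((i : ℤ) - n) / 2 : ℤ) : R) * ((((k : ℤ) - n) / 2 : ℤ) : R)), ← h3,
      Finset.mul_sum]
    exact Finset.sum_congr rfl fun j _ ↦ by ring
  obtain ⟨e, z, he, hz⟩ := exists_prod_add_two_mul (-(n : R)) w Finset.univ
  rw [hw1, hw2] at he
  have he0 : e = 0 := by
    have : (2 : R) ≠ 0 := two_ne_zero
    simpa [this] using he
  -- Multiplying each F'(x_i) by x_i changes the product only by ∏ x_i = -1.
  have hprod : ∏ i, (-(n : R) + 2 * w i) = -∏ i, ∏ j ∈ {i}ᶜ, (x i - x j) := by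
    rw [← neg_one_mul (∏ i, ∏ j ∈ {i}ᶜ, (x i - x j)),
      ← prod_roots_sparsePoly hn (fun i hi ↦ (hS' i hi).1) hx, ← Finset.prod_mul_distrib]
    refine Finset.prod_congr rfl fun i _ ↦ ?_
    rw [← eval_derivative_prod_X_sub_C, ← hx, root_mul_eval_derivative_sparsePoly hn
      (fun i hi ↦ (hS i hi).1)]
    rw [hx, eval_prod]
    exact Finset.prod_eq_zero (Finset.mem_univ i) (by simp)
  rw [hprod, hw1, he0, Finset.card_univ, Fintype.card_fin, hn.neg_pow] at hz
  exact ⟨-z, by linear_combination -hz⟩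

end

/-! ### Roots as algebraic integers. -/

theorem exists_roots_integralClosure {n : ℕ} (F : ℤ[X]) (hF : F.Monic) (hdeg : F.natDegree = n) :
    ∃ x : Fin n → integralClosure ℤ ℂ,
      F.map (Int.castRingHom (integralClosure ℤ ℂ)) = ∏ i, (X - C (x i)) := by
  have hs := IsAlgClosed.splits (F.map (Int.castRingHom ℂ))
  have hmon := hF.map (Int.castRingHom ℂ)
  have hcard : Multiset.card (F.map (Int.castRingHom ℂ)).roots = n := by
    rw [← hs.natDegree_eq_card_roots, hF.natDegree_map, hdeg]
  obtain ⟨l, hl⟩ := Quot.exists_rep (F.map (Int.castRingHom ℂ)).roots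
  have hl' : (l : Multiset ℂ) = (F.map (Int.castRingHom ℂ)).roots := hl
  have hlen : l.length = n := by rw [← hcard, ← hl']; rfl
  subst hlen
  have hint : ∀ i : Fin l.length, l.get i ∈ integralClosure ℤ ℂ := by
    intro i
    refine ⟨F, hF, ?_⟩
    have : l.get i ∈ (F.map (Int.castRingHom ℂ)).roots := by
      rw [← hl']; exact List.get_mem l i
    have := (mem_roots'.1 this).2
    rw [IsRoot.def, eval_map] at this
    exact this
  refine ⟨fun i ↦ ⟨l.get i, hint i⟩, ?_⟩
  apply Polynomial.map_injective (algebraMap (integralClosure ℤ ℂ) ℂ) Subtype.val_injective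
  rw [Polynomial.map_map, Polynomial.map_prod]
  have h1 : (algebraMap (integralClosure ℤ ℂ) ℂ).comp (Int.castRingHom (integralClosure ℤ ℂ)) =
    Int.castRingHom ℂ := RingHom.ext_int _ _
  rw [h1, hs.eq_prod_roots_of_monic hmon, ← hl']
  simp only [Polynomial.map_sub, Polynomial.map_X, Polynomial.map_C]
  rw [Multiset.map_coe, Multiset.prod_coe, ← List.prod_ofFn]
  congr 1
  apply List.ext_get <;> simp

/-- The quotient is a rational algebraic integer, hence an integer. -/
theorem int_dvd_of_dvd_integralClosure {a b : ℤ} (ha : a ≠ 0)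
    (h : (a : integralClosure ℤ ℂ) ∣ (b : integralClosure ℤ ℂ)) : a ∣ b := by
  obtain ⟨z, hz⟩ := h
  have hz' : (b : ℂ) = a * (z : ℂ) := by
    have := congrArg (algebraMap (integralClosure ℤ ℂ) ℂ) hz
    simpa using this
  have hq : algebraMap ℚ ℂ ((b : ℚ) / a) = z := by
    have : (a : ℂ) ≠ 0 := by exact_mod_cast ha
    simp only [map_div₀, map_intCast]
    rw [hz']
    field_simp
  have hi : IsIntegral ℤ ((b : ℚ) / a) := by
    rw [← isIntegral_algebraMap_iff (algebraMap ℚ ℂ).injective, hq]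
    exact z.2
  obtain ⟨c, hc⟩ := IsIntegrallyClosed.isIntegral_iff.1 hi
  refine ⟨c, ?_⟩
  have : (a : ℚ) ≠ 0 := by exact_mod_cast ha
  rw [eq_div_iff this] at hc
  have h2 : (c : ℚ) * a = b := by simpa using hc
  have h3 : c * a = b := by exact_mod_cast h2
  rw [← h3, mul_comm]

/-! ### Conjugates of a root over 𝔽₂. -/

section

variable {K : Type*} [Field K] [Algebra (ZMod 2) K] {f : (ZMod 2)[X]} {n : ℕ} {α : K}

theorem monic_of_irreducible_zmod_two (hf : Irreducible f) : f.Monic := by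
  have h : ∀ a : ZMod 2, a ≠ 0 → a = 1 := by decide
  exact h _ (leadingCoeff_ne_zero.2 hf.ne_zero)

theorem pow_two_pow_eq_self_iff_natDegree_dvd (hf : Irreducible f) (hα : aeval α f = 0) (d : ℕ) :
    α ^ 2 ^ d = α ↔ f.natDegree ∣ d := by
  rw [hf.natDegree_dvd_iff_dvd_X_pow_card_pow_sub_X, ← hf.dvd_iff_aeval_eq_zero hα]
  simp [sub_eq_zero]

theorem conjugates_injective (hf : Irreducible f) (hdeg : f.natDegree = n) (hα : aeval α f = 0) :
    Function.Injective (fun i : Fin n ↦ α ^ 2 ^ (i : ℕ)) := by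
  have : CharP K 2 := charP_of_injective_algebraMap (algebraMap (ZMod 2) K).injective 2
  have key : ∀ i j : ℕ, i < j → j < n → α ^ 2 ^ i ≠ α ^ 2 ^ j := by
    intro i j hij hj h
    have h1 : (α ^ 2 ^ (j - i)) ^ 2 ^ i = α ^ 2 ^ i := by
      rw [← pow_mul, ← pow_add, Nat.sub_add_cancel hij.le, h]
    have h2 : α ^ 2 ^ (j - i) = α := by
      apply iterateFrobenius_inj K 2 i
      simpa [iterateFrobenius_def] using h1
    have h3 := Nat.le_of_dvd (by omega) ((pow_two_pow_eq_self_iff_natDegree_dvd hf hα _).1 h2)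
    omega
  intro i j h
  rcases lt_trichotomy i.1 j.1 with hij | hij | hij
  · exact absurd h (key _ _ hij j.2)
  · exact Fin.ext hij
  · exact absurd h.symm (key _ _ hij i.2)

theorem conjugates_sq (hf : Irreducible f) (hdeg : f.natDegree = n) (hα : aeval α f = 0)
    (i : Fin n) : (α ^ 2 ^ (i : ℕ)) ^ 2 = α ^ 2 ^ (finRotate n i : ℕ) := by
  rw [← pow_mul, ← pow_succ]
  obtain _ | m := n
  · exact i.elim0
  · rcases eq_or_ne i (Fin.last m) with rfl | hi
    · rw [finRotate_last]
      simpa using (pow_two_pow_eq_self_iff_natDegree_dvd hf hα (m + 1)).2 hdeg.dvd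
    · rw [coe_finRotate_of_ne_last hi]

theorem map_eq_prod_conjugates (hf : Irreducible f) (hdeg : f.natDegree = n)
    (hα : aeval α f = 0) :
    f.map (algebraMap (ZMod 2) K) = ∏ i : Fin n, (X - C (α ^ 2 ^ (i : ℕ))) := by
  have : CharP K 2 := charP_of_injective_algebraMap (algebraMap (ZMod 2) K).injective 2
  have hmon := (monic_of_irreducible_zmod_two hf).map (algebraMap (ZMod 2) K)
  have hmonP : (∏ i : Fin n, (X - C (α ^ 2 ^ (i : ℕ)))).Monic :=
    monic_prod_of_monic _ _ fun i _ ↦ monic_X_sub_C _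
  refine eq_of_monic_of_dvd_of_natDegree_le hmonP hmon ?_ ?_
  · refine Finset.prod_dvd_of_coprime
      (fun i _ j _ hij ↦ pairwise_coprime_X_sub_C (conjugates_injective hf hdeg hα) hij)
      fun i _ ↦ ?_
    rw [dvd_iff_isRoot, IsRoot.def, eval_map_algebraMap]
    have h := congrArg (iterateFrobenius K 2 i) hα
    rw [map_zero, aeval_def, hom_eval₂] at h
    rw [aeval_def, ← h, iterateFrobenius_def]
    congr 1
    exact RingHom.ext_zmod _ _
  · rw [natDegree_prod_of_monic _ _ fun i _ ↦ monic_X_sub_C _]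
    simp only [natDegree_X_sub_C, natDegree_map, hdeg]
    simp

end

/-! ### Integral lift and the contradiction modulo 8. -/

theorem sparsePoly_map_zmod_two {f : (ZMod 2)[X]} {n : ℕ} (hn : 1 < n) (hf : Irreducible f)
    (hdeg : f.natDegree = n) :
    (sparsePoly n {k ∈ Finset.Ioo 0 n | f.coeff k ≠ 0}).map (Int.castRingHom (ZMod 2)) = f := by
  have h2 : ∀ a : ZMod 2, a ≠ 0 → a = 1 := by decide
  have h0 : f.coeff 0 = 1 := by
    refine h2 _ fun h ↦ ?_
    obtain ⟨g, rfl⟩ := X_dvd_iff.2 h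
    have hg := (hf.isUnit_or_isUnit rfl).resolve_left not_isUnit_X
    rw [natDegree_mul X_ne_zero hg.ne_zero, natDegree_X, natDegree_eq_zero_of_isUnit hg] at hdeg
    omega
  have hlead : f.coeff n = 1 := by
    rw [← hdeg]
    exact monic_of_irreducible_zmod_two hf
  ext k
  rw [coeff_map, coeff_sparsePoly]
  rcases Nat.eq_zero_or_pos k with rfl | hk
  · simp [h0, (show 0 ≠ n by omega)]
  rcases lt_trichotomy k n with h | rfl | h
  · by_cases hc : f.coeff k = 0
    · simp [hc, hk.ne', h.ne]
    · simp [h2 _ hc, hk.ne', h.ne, h, hk]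
  · simp [hlead, hk.ne']
  · simp [coeff_eq_zero_of_natDegree_lt (hdeg.trans_lt h), hk.ne', h.ne', h.not_gt]

/-- A polynomial over `𝔽₂` of degree `n ≡ ±3 mod 8` whose middle terms all have odd exponents
less than `n / 3` is reducible. -/
theorem not_irreducible_of_coeff {f : (ZMod 2)[X]} {n : ℕ}
    (hn : (n : ℤ) ≡ 3 [ZMOD 8] ∨ (n : ℤ) ≡ -3 [ZMOD 8]) (hdeg : f.natDegree = n)
    (hf : ∀ k, 0 < k → k < n → f.coeff k ≠ 0 → Odd k ∧ 3 * k < n) : ¬ Irreducible f := by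
  intro hirr
  have hn8 : n % 8 = 3 ∨ n % 8 = 5 := by
    simp only [Int.ModEq] at hn
    omega
  have hodd : Odd n := Nat.odd_iff.2 (by omega)
  set S := {k ∈ Finset.Ioo 0 n | f.coeff k ≠ 0} with hSdef
  have hS : ∀ i ∈ S, Odd i ∧ 3 * i < n := by
    intro i hi
    simp only [hSdef, Finset.mem_filter, Finset.mem_Ioo] at hi
    exact hf i hi.1.1 hi.1.2 hi.2
  have hmap := sparsePoly_map_zmod_two (by omega) hirr hdeg
  rw [← hSdef] at hmap
  have hS0 : n ∉ S := fun h ↦ by have := hS n h; omega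
  have hFn : (sparsePoly n S).coeff n = 1 := by
    rw [coeff_sparsePoly, if_pos rfl, if_neg hS0, if_neg hodd.pos.ne']
    simp
  have hFdeg : (sparsePoly n S).natDegree = n := by
    refine natDegree_eq_of_le_of_coeff_ne_zero (natDegree_le_iff_coeff_eq_zero.2 fun k hk ↦ ?_)
      (by rw [hFn]; exact one_ne_zero)
    rw [coeff_sparsePoly, if_neg hk.ne', if_neg fun h ↦ by have := hS k h; omega,
      if_neg (by omega)]
    simp
  have hFmon : (sparsePoly n S).Monic := by
    rw [Monic, leadingCoeff, hFdeg, hFn]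
  obtain ⟨x, hx⟩ := exists_roots_integralClosure _ hFmon hFdeg
  have : Fact (Irreducible f) := ⟨hirr⟩
  have : CharP (AdjoinRoot f) 2 :=
    charP_of_injective_algebraMap (algebraMap (ZMod 2) (AdjoinRoot f)).injective 2
  have hα : aeval (AdjoinRoot.root f) f = 0 := by simp
  have hy : (sparsePoly n S).map (Int.castRingHom (AdjoinRoot f)) =
      ∏ i : Fin n, (X - C (AdjoinRoot.root f ^ 2 ^ (i : ℕ))) := by
    refine Eq.trans ?_ ((congrArg (Polynomial.map _) hmap).trans
      (map_eq_prod_conjugates hirr hdeg hα))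
    rw [Polynomial.map_map]
    congr 1
  obtain ⟨N, hN, hN1⟩ := exists_int_det_vandermonde_sq hodd _ x _ hx hy
    (conjugates_sq hirr hdeg hα) (conjugates_injective hirr hdeg hα)
  obtain ⟨z, hz⟩ := exists_prod_eval_derivative_sparsePoly hodd hS hx
  obtain ⟨m, hm⟩ := exists_neg_one_pow_mul_det_vandermonde_sq x
  rw [hm, hN] at hz
  have hdvd : (8 : ℤ) ∣ (n : ℤ) ^ 2 * ((-1) ^ m * N) - (n : ℤ) ^ (n + 2) := by
    refine int_dvd_of_dvd_integralClosure (by norm_num) ⟨z, ?_⟩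
    push_cast
    linear_combination hz
  have hn2 : (n : ℤ) ^ 2 ≡ 1 [ZMOD 8] := by
    rcases hn with h | h <;> exact (h.pow 2).trans (by decide)
  have hnn : (n : ℤ) ^ (n + 2) ≡ n [ZMOD 8] := by
    obtain ⟨b, hb⟩ := hodd
    have h3 : (n : ℤ) ^ (n + 2) = ((n : ℤ) ^ 2) ^ (b + 1) * n := by
      rw [← pow_mul, ← pow_succ]
      congr 1
      omega
    rw [h3]
    simpa using (hn2.pow (b + 1)).mul_right (n : ℤ)
  have h1 : (n : ℤ) ^ 2 * ((-1) ^ m * N) ≡ (-1) ^ m [ZMOD 8] := by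
    simpa using hn2.mul (hN1.mul_left ((-1) ^ m))
  have h2 : (n : ℤ) ≡ (-1) ^ m [ZMOD 8] :=
    (hnn.symm.trans (Int.modEq_iff_dvd.2 hdvd)).trans h1
  rcases neg_one_pow_eq_or ℤ m with h | h <;> rw [h, Int.ModEq] at h2 <;> omega

/-- The traces are the power sums of the conjugates, so Newton gives j·e_j = 0 for j < n. For j odd,
e_j = 0 in characteristic 2; since n is odd, j = n - k is odd exactly when k is even. -/
theorem odd_of_coeff_ne_zero_of_trace {K : Type*} [Field K] [Algebra (ZMod 2) K] [Finite K]
    {f : (ZMod 2)[X]} {n : ℕ} {α : K} (hn : Odd n) (hcard : Nat.card K = 2 ^ n)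
    (hf : Irreducible f) (hdeg : f.natDegree = n) (hα : aeval α f = 0)
    (htr : ∀ i : ℕ, 1 ≤ i → i < n → Algebra.trace (ZMod 2) K (α ^ i) = 0)
    {k : ℕ} (hk : 0 < k) (hkn : k < n) (hfk : f.coeff k ≠ 0) : Odd k := by
  by_contra hodd
  have : CharP K 2 := charP_of_injective_algebraMap (algebraMap (ZMod 2) K).injective 2
  have hrank : Module.finrank (ZMod 2) K = n := by
    have := FiniteField.pow_finrank_eq_natCard 2 K
    rw [hcard] at this
    exact Nat.pow_right_injective le_rfl this
  have hsum : ∀ i, 0 < i → i ≤ n - 1 → ∑ j : Fin n, (α ^ 2 ^ (j : ℕ)) ^ i = 0 := by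
    intro i hi hin
    have h := FiniteField.algebraMap_trace_eq_sum_pow (ZMod 2) K (α ^ i)
    rw [htr i hi (by omega), map_zero, hrank, Nat.card_zmod, Finset.sum_range] at h
    rw [h]
    exact Finset.sum_congr rfl fun j _ ↦ pow_right_comm _ _ _
  have hev : Odd (n - k) := Nat.Odd.sub_even hkn.le hn (Nat.not_odd_iff_even.1 hodd)
  have h := mul_esymm_eq_zero_of_sum_pow _ (n - 1) hsum (k := n - k) (by omega)
  have hcast : ((n - k : ℕ) : K) = 1 := by
    obtain ⟨b, hb⟩ := hev
    rw [hb]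
    push_cast
    rw [CharTwo.two_eq_zero]
    simp
  rw [hcast, one_mul, aeval_esymm_of_prod _ (map_eq_prod_conjugates hf hdeg hα) (by omega),
    Nat.sub_sub_self hkn.le, coeff_map] at h
  simp [hfk] at h

theorem mainTheorem2 (n : ℕ) (hn : (n : ℤ) ≡ 3 [ZMOD 8] ∨ (n : ℤ) ≡ -3 [ZMOD 8]) :
    (∀ (K : Type*) [Field K] [Algebra (ZMod 2) K] (f : (ZMod 2)[X]) (α : K),
      Nat.card K = 2 ^ n → Irreducible f → f.natDegree = n → aeval α f = 0 →
      (∀ i : ℕ, 1 ≤ i → i < n → Algebra.trace (ZMod 2) K (α ^ i) = 0) →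
      ∃ k : ℕ, k < n ∧ (n : ℚ) / 3 ≤ (k : ℚ) ∧ f.coeff k ≠ 0) ∧
    (∀ m₁ m₂ m₃ : ℕ, Odd m₁ → Odd m₂ → Odd m₃ → m₂ < m₁ → m₃ < m₂ →
      (m₁ : ℚ) < (n : ℚ) / 3 →
      ¬ Irreducible (X ^ n + X ^ m₁ + X ^ m₂ + X ^ m₃ + 1 : (ZMod 2)[X])) := by
  refine ⟨?_, ?_⟩
  · intro K _ _ f α hcard hf hdeg hα htr
    by_contra! hcon
    have : Finite K := Nat.finite_of_card_ne_zero (by rw [hcard]; positivity)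
    have hodd : Odd n := by
      simp only [Int.ModEq] at hn
      exact Nat.odd_iff.2 (by omega)
    refine not_irreducible_of_coeff hn hdeg (fun k hk hkn hfk ↦
      ⟨odd_of_coeff_ne_zero_of_trace hodd hcard hf hdeg hα htr hk hkn hfk, ?_⟩) hf
    by_contra hlt
    refine hfk (hcon k hkn ?_)
    have : (n : ℚ) ≤ 3 * k := by exact_mod_cast not_lt.1 hlt
    linarith
  · intro m₁ m₂ m₃ h₁ h₂ h₃ h₂₁ h₃₂ hlt
    have hlt' : 3 * m₁ < n := by
      have : (3 * m₁ : ℚ) < n := by linarith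
      exact_mod_cast this
    have hdeg : (X ^ n + X ^ m₁ + X ^ m₂ + X ^ m₃ + 1 : (ZMod 2)[X]).natDegree = n := by
      compute_degree!
      · simp [(show n ≠ m₁ by omega), (show n ≠ m₂ by omega), (show n ≠ m₃ by omega),
          (show n ≠ 0 by omega)]
      all_goals omega
    refine not_irreducible_of_coeff hn hdeg fun k hk hkn hc ↦ ?_
    simp only [coeff_add, coeff_X_pow, coeff_one] at hc
    have : k = m₁ ∨ k = m₂ ∨ k = m₃ := by
      by_contra! h
      simp [h, hk.ne', hkn.ne] at hc
    rcases this with rfl | rfl | rfl <;> exact ⟨by assumption, by omega⟩
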